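/- Conventions. A graph sequence $\mathcal G=(G_n)_{n\in\mathbb N}$ is a sequence of finite connected graphs of uniformly bounded degree with $|V(G_n)|\to\infty$. Its edge number is $e(\mathcal G)=\liminf_{n\to\infty}|E(G_n)|/|V(G_n)|$. For two graph sequences with $V(G_n)=V(H_n)$ for all $n$, write $\mathcal G\simeq\mathcal H$ if there is an $L>0$ such that for every $n$ the identity map on vertices $G_n\to H_n$ is $L$-bi-Lipschitz for the path metrics. The cost of $\mathcal G$ is $c(\mathcal G)=\inf_{\mathcal H\simeq\mathcal G}e(\mathcal H)$. For a group $\Gamma$ with finite generating set $S$ and a subgroup $N\le\Gamma$, the labelled Schreier graph $\mathrm{Sch}(\Gamma,N,S)$ has as vertices the right cosets $Ng$, with an edge labelled $s$ from $Ng$ to $Ngs$ for each $s\in S$; $\mathrm{Cay}(\Gamma,S)=\mathrm{Sch}(\Gamma,\{1\},S)$. For edge numbers and costs one uses the underlying simple undirected graph. A sequence $(N_k)_{k\in\mathbb N}$ of finite index subgroups of $\Gamma$ is a Farber sequence if for every $r\in\mathbb N$ the proportion of vertices of $\mathrm{Sch}(\Gamma,N_k,S)$ whose $r$-ball is isomorphic,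 as a rooted labelled graph, to the $r$-ball around $1$ in $\mathrm{Cay}(\Gamma,S)$ tends to $1$ as $k\to\infty$. Theorem. Let $\Gamma$ be an infinite residually finite group with finite generating set $S$, let $\Lambda\le\Gamma$ be a subgroup of finite index with finite generating set $S'$, and let $(N_k)_{k\in\mathbb N}$ be a Farber sequence of $\Gamma$ with $N_k\le\Lambda$ for all $k$. Then $\mathcal G=(\mathrm{Sch}(\Gamma,N_k,S))_{k\in\mathbb N}$ and $\mathcal H=(\mathrm{Sch}(\Lambda,N_k,S'))_{k\in\mathbb N}$ are graph sequences, and $$[\Gamma:\Lambda]\,(c(\mathcal G)-1)=c(\mathcal H)-1 .$$ -/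

import Mathlib

open Filter Topology

/-- A directed graph on the vertex type `V` whose edges carry labels in `S`
(loops and several edges with different labels between the same vertices are allowed). -/
structure LabelledGraph (S : Type*) (V : Type*) where
  /-- `edge s x y`: there is an edge labelled `s` from `x` to `y`. -/
  edge : S → V → V → Prop

namespace LabelledGraph

variable {S V W : Type*}

/-- The underlying simple undirected graph: labels, orientations, loops and multiplicities are
forgotten. It has the same path metric as the labelled graph. -/
def toSimple (G : LabelledGraph S V) : SimpleGraph V :=
  SimpleGraph.fromRel fun x y => ∃ s, G.edge s x y

/-- The vertex set of the `r`-ball around `x`. -/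
def ball (G : LabelledGraph S V) (x : V) (r : ℕ) : Set V :=
  {y | G.toSimple.edist x y ≤ r}

/-- The `r`-ball of `G` around `x` and the `r`-ball of `H` around `y` are isomorphic as rooted
labelled directed graphs (with the induced edges). -/
def BallIso (G : LabelledGraph S V) (x : V) (H : LabelledGraph S W) (y : W) (r : ℕ) : Prop :=
  ∃ e : G.ball x r ≃ H.ball y r,
    (∀ u : G.ball x r, (u : V) = x ↔ (e u : W) = y) ∧
    ∀ (s : S) (u v : G.ball x r), G.edge s u v ↔ H.edge s (e u) (e v)

/-- `p_r(G, B_r(H, y))`: the proportion of the vertices of the finite graph `G` whose `r`-ball is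
isomorphic to the `r`-ball of `H` around `y`. -/
noncomputable def ballDensity (G : LabelledGraph S V) (H : LabelledGraph S W) (y : W) (r : ℕ) :
    ℝ :=
  ({x : V | G.BallIso x H y r}.ncard : ℝ) / (Nat.card V : ℝ)

end LabelledGraph

section Schreier

variable {Γ : Type*} [Group Γ]

/-- The set `N \ Γ` of right cosets `N g`. -/
abbrev RightCosets (N : Subgroup Γ) : Type _ := Quotient (QuotientGroup.rightRel N)

/-- The labelled Schreier graph `Sch(Γ, N, S)` on the right cosets of `N`: for every `s ∈ S` there
is an edge labelled `s` from `N g` to `N g s`. -/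
def schreierGraph (N : Subgroup Γ) (S : Finset Γ) : LabelledGraph S (RightCosets N) where
  edge s x y := ∃ g : Γ, x = Quotient.mk _ g ∧ y = Quotient.mk _ (g * (s : Γ))

/-- The Cayley graph `Cay(Γ, S) = Sch(Γ, {1}, S)`. -/
def cayleyGraph (S : Finset Γ) : LabelledGraph S (RightCosets (⊥ : Subgroup Γ)) :=
  schreierGraph ⊥ S

/-- `(N k)` is a Farber sequence of `Γ` (with finite generating set `S`): the `N k` have finite
index, and the Schreier graphs `Sch(Γ, N k, S)` converge in the sense of Benjamini and Schramm to
`Cay(Γ, S)`. -/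
structure IsFarber (S : Finset Γ) (N : ℕ → Subgroup Γ) : Prop where
  finiteIndex : ∀ k, (N k).FiniteIndex
  tendsto : ∀ r : ℕ, Tendsto
    (fun k => (schreierGraph (N k) S).ballDensity (cayleyGraph S) (Quotient.mk _ (1 : Γ)) r)
    atTop (𝓝 1)

end Schreier

section Cost

variable {V : ℕ → Type*}

/-- A graph sequence: finite connected graphs of uniformly bounded degree whose numbers of vertices
tend to infinity. -/
structure IsGraphSequence (G : ∀ n, SimpleGraph (V n)) : Prop where
  finite : ∀ n, Finite (V n)
  connected : ∀ n, (G n).Connected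
  boundedDegree : ∃ d : ℕ, ∀ n, ∀ v : V n, ((G n).neighborSet v).ncard ≤ d
  tendsto_card : Tendsto (fun n => Nat.card (V n)) atTop atTop

/-- `e(G) = liminf |E(G_n)| / |V(G_n)|`. -/
noncomputable def edgeNumber (G : ∀ n, SimpleGraph (V n)) : ℝ :=
  liminf (fun n => ((G n).edgeSet.ncard : ℝ) / (Nat.card (V n) : ℝ)) atTop

/-- `G ≃ H` for graph sequences on the same vertex sets: the identity on the vertices is
`L`-bi-Lipschitz for the path metrics, with one constant `L > 0` for all `n`. -/
def BiLipschitzEquiv (G H : ∀ n, SimpleGraph (V n)) : Prop :=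
  ∃ L : ℝ, 0 < L ∧ ∀ n, ∀ x y : V n,
    ((G n).dist x y : ℝ) / L ≤ ((H n).dist x y : ℝ) ∧
    ((H n).dist x y : ℝ) ≤ L * ((G n).dist x y : ℝ)

/-- The cost `c(G)`: the infimum of the edge numbers `e(H)` over all graph sequences `H ≃ G`. -/
noncomputable def cost (G : ∀ n, SimpleGraph (V n)) : ℝ :=
  sInf {e : ℝ | ∃ H : ∀ n, SimpleGraph (V n),
    IsGraphSequence H ∧ BiLipschitzEquiv G H ∧ e = edgeNumber H}

end Cost

/-! Write m = [Γ : Λ]. The point is that |E| − |V| can be carried between the two vertex sets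
without increasing. Cosets of N in Λ are cosets of N in Γ, and a left Λ-equivariant retraction Γ →
Λ, which moves each element by right multiplication by one of finitely many elements, induces a map
back. So the Schreier graph of Λ is a coarsely dense coarse retract of that of Γ, with a constant
independent of N ≤ Λ (`exists_coarseRetract_schreierGraph`) and m times fewer vertices. Replacing
either graph by a bi-Lipschitz equivalent one only changes the constant.

A competitor on the small vertex set extends to the large one by one pendant edge per missing vertex
(`exists_extension`). A competitor on the large set is contracted along a spanning forest rooted in
the small set, which loses at least one edge per lost vertex (`exists_contraction`). Both
constructions keep degrees bounded and stay in the right bi-Lipschitz class. Dividing by the numbers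
of vertices and passing to liminf and infimum gives the two inequalities. The Farber condition
provides finite indices tending to infinity. -/

namespace SimpleGraph

variable {V W : Type*}

/-! ### Lipschitz maps, balls and edge counts -/

theorem reachable_map_of_adj {A : SimpleGraph V} {B : SimpleGraph W} (f : V → W)
    (h : ∀ x y, A.Adj x y → B.Reachable (f x) (f y)) {x y : V} (hxy : A.Reachable x y) :
    B.Reachable (f x) (f y) := by
  obtain ⟨p⟩ := hxy
  induction p with
  | nil => exact Reachable.refl _
  | cons hadj _ ih => exact (h _ _ hadj).trans ih

theorem Connected.of_surjective {A : SimpleGraph V} {B : SimpleGraph W} (hA : A.Connected)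
    {f : V → W} (hf : f.Surjective) (h : ∀ x y, A.Adj x y → B.Reachable (f x) (f y)) :
    B.Connected := by
  have := hA.nonempty
  have : Nonempty W := ‹Nonempty V›.map f
  refine ⟨fun a b => ?_⟩
  obtain ⟨x, rfl⟩ := hf a
  obtain ⟨y, rfl⟩ := hf b
  exact reachable_map_of_adj f h (hA.preconnected x y)

theorem dist_map_le {A : SimpleGraph V} {B : SimpleGraph W} (hA : A.Connected)
    (hB : B.Connected) (f : V → W) {C : ℕ} (h : ∀ x y, A.Adj x y → B.dist (f x) (f y) ≤ C)
    (x y : V) : B.dist (f x) (f y) ≤ C * A.dist x y := by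
  obtain ⟨p, hp⟩ := hA.exists_walk_length_eq_dist x y
  rw [← hp]
  clear hp
  induction p with
  | nil => simp
  | @cons u v w hadj p ih =>
    rw [Walk.length_cons]
    have h1 := hB.dist_triangle (u := f u) (v := f v) (w := f w)
    have h2 := h _ _ hadj
    calc _ ≤ C + C * p.length := by omega
      _ = _ := by ring

theorem dist_le_one_of_eq_or_adj {A : SimpleGraph V} {x y : V} (h : x = y ∨ A.Adj x y) :
    A.dist x y ≤ 1 := by
  rcases h with rfl | h
  · simp
  · exact (dist_eq_one_iff_adj.2 h).le

/-- A ball of radius R + 1 is covered by the R-balls around its centre and the at most d neighbours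
of the centre. -/
theorem ncard_closedBall_le [Finite V] {G : SimpleGraph V} (hG : G.Connected) {d : ℕ}
    (hd : ∀ v, (G.neighborSet v).ncard ≤ d) (R : ℕ) (v : V) :
    {u | G.dist v u ≤ R}.ncard ≤ (d + 1) ^ R := by
  classical
  have := Fintype.ofFinite V
  induction R generalizing v with
  | zero =>
    have : {u | G.dist v u ≤ 0} = {v} := by
      ext u
      rw [Set.mem_ofPred_eq, Nat.le_zero, hG.dist_eq_zero_iff, Set.mem_singleton_iff, eq_comm]
    rw [this, Set.ncard_singleton, pow_zero]
  | succ R ih =>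
    have hsub : {u | G.dist v u ≤ R + 1} ⊆
        ((insert v (G.neighborFinset v)).biUnion fun w => {u | G.dist w u ≤ R} : Finset V) := by
      intro u hu
      simp only [Finset.coe_biUnion, Set.mem_iUnion, Finset.coe_filter, Finset.mem_coe,
        Finset.mem_insert, mem_neighborFinset, Finset.mem_univ, true_and, Set.mem_ofPred_eq] at hu ⊢
      obtain ⟨p, hp⟩ := hG.exists_walk_length_eq_dist v u
      cases p with
      | nil => exact ⟨v, Or.inl rfl, by simp⟩
      | cons hadj p =>
        refine ⟨_, Or.inr hadj, (dist_le p).trans ?_⟩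
        rw [Walk.length_cons] at hp
        omega
    have h1 := Set.ncard_le_ncard hsub (Finset.finite_toSet _)
    rw [Set.ncard_coe_finset] at h1
    refine h1.trans ((Finset.card_biUnion_le_card_mul _ _ ((d + 1) ^ R) ?_).trans ?_)
    · intro w _
      rw [← Set.ncard_coe_finset]
      simpa using ih w
    · rw [pow_succ, mul_comm]
      refine Nat.mul_le_mul_left _ ((Finset.card_insert_le _ _).trans ?_)
      have := hd v
      rw [← coe_neighborFinset, Set.ncard_coe_finset] at this
      omega

theorem ncard_edgeSet_le [Finite V] {G : SimpleGraph V} {d : ℕ}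
    (hd : ∀ v, (G.neighborSet v).ncard ≤ d) : G.edgeSet.ncard ≤ d * Nat.card V := by
  classical
  have := Fintype.ofFinite V
  rw [← coe_edgeFinset, Set.ncard_coe_finset, Nat.card_eq_fintype_card]
  have h1 := G.sum_degrees_eq_twice_card_edges
  have h2 : ∑ v, G.degree v ≤ ∑ _v : V, d := by
    refine Finset.sum_le_sum fun v _ => ?_
    have := hd v
    rwa [← coe_neighborFinset, Set.ncard_coe_finset] at this
  rw [Finset.sum_const, Finset.card_univ, smul_eq_mul, mul_comm] at h2
  omega

/-! ### Coarse retracts: pendant extension and forest contraction -/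

/-- `ι` and `p` exhibit the graph `H` as a coarse retract of `G` that is coarsely dense, with
constant `C`. -/
structure CoarseRetract (G : SimpleGraph V) (H : SimpleGraph W) (ι : W → V) (p : V → W)
    (C : ℕ) : Prop where
  leftInv : ∀ w, p (ι w) = w
  dist_incl : ∀ x y, H.Adj x y → G.dist (ι x) (ι y) ≤ C
  dist_retr : ∀ u v, G.Adj u v → H.dist (p u) (p v) ≤ C
  dist_self : ∀ v, G.dist v (ι (p v)) ≤ C

namespace CoarseRetract

variable {G : SimpleGraph V} {H : SimpleGraph W} {ι : W → V} {p : V → W} {C : ℕ}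

theorem mono (h : CoarseRetract G H ι p C) {D : ℕ} (hD : C ≤ D) : CoarseRetract G H ι p D :=
  ⟨h.leftInv, fun x y hxy => (h.dist_incl x y hxy).trans hD,
    fun x y hxy => (h.dist_retr x y hxy).trans hD, fun v => (h.dist_self v).trans hD⟩

/-- Needed because the infimum defining the cost ranges over all graphs bi-Lipschitz to the given
one; `congr_right` does the same for the small graph. -/
theorem congr_left (h : CoarseRetract G H ι p C) (hG : G.Connected) (hH : H.Connected)
    {G' : SimpleGraph V} {D : ℕ}
    (h1 : ∀ x y, G.dist x y ≤ D * G'.dist x y) (h2 : ∀ x y, G'.dist x y ≤ D * G.dist x y) :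
    CoarseRetract G' H ι p (D * C) := by
  refine ⟨h.leftInv, fun x y hxy => ?_, fun u v huv => ?_, fun v => ?_⟩
  · exact (h2 _ _).trans (Nat.mul_le_mul_left _ (h.dist_incl x y hxy))
  · refine (dist_map_le hG hH p h.dist_retr u v).trans ?_
    rw [mul_comm]
    refine Nat.mul_le_mul_right _ ((h1 _ _).trans ?_)
    rw [dist_eq_one_iff_adj.2 huv, mul_one]
  · exact (h2 _ _).trans (Nat.mul_le_mul_left _ (h.dist_self v))

theorem congr_right (h : CoarseRetract G H ι p C) (hG : G.Connected) (hH : H.Connected)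
    {H' : SimpleGraph W} {D : ℕ} (hD : 0 < D)
    (h1 : ∀ x y, H.dist x y ≤ D * H'.dist x y) (h2 : ∀ x y, H'.dist x y ≤ D * H.dist x y) :
    CoarseRetract G H' ι p (D * C) := by
  refine ⟨h.leftInv, fun x y hxy => ?_, fun u v huv => ?_, fun v => ?_⟩
  · refine (dist_map_le hH hG ι h.dist_incl x y).trans ?_
    rw [mul_comm]
    refine Nat.mul_le_mul_right _ ((h1 _ _).trans ?_)
    rw [dist_eq_one_iff_adj.2 hxy, mul_one]
  · exact (h2 _ _).trans (Nat.mul_le_mul_left _ (h.dist_retr u v huv))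
  · exact (h.dist_self v).trans (Nat.le_mul_of_pos_left _ hD)

/-- A coarse retract extends to the ambient vertex set, with one pendant edge for every new
vertex. -/
theorem exists_extension [Finite V] (h : CoarseRetract G H ι p C) (hG : G.Connected)
    (hH : H.Connected) {d d' : ℕ} (hd : ∀ v, (G.neighborSet v).ncard ≤ d)
    (hd' : ∀ w, (H.neighborSet w).ncard ≤ d') :
    ∃ K : SimpleGraph V, K.Connected ∧
      (∀ v, (K.neighborSet v).ncard ≤ d' + 1 + (d + 1) ^ C) ∧
      K.edgeSet.ncard + Nat.card W ≤ H.edgeSet.ncard + Nat.card V ∧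
      (∀ x y, G.dist x y ≤ (C + 2) * K.dist x y) ∧
      (∀ x y, K.dist x y ≤ (C + 2) * G.dist x y) := by
  have hι : ι.Injective := Function.LeftInverse.injective h.leftInv
  have : Finite W := Finite.of_injective ι hι
  -- A copy of `H`, with every vertex v outside it hung on ι (p v).
  let K : SimpleGraph V := H.map ι ⊔ SimpleGraph.fromRel fun v u => u = ι (p v)
  have hpend : ∀ v, v = ι (p v) ∨ K.Adj v (ι (p v)) := by
    intro v
    by_cases hv : v = ι (p v)
    · exact Or.inl hv
    · exact Or.inr (Or.inr ((SimpleGraph.fromRel_adj _ _ _).2 ⟨hv, Or.inl rfl⟩))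
  have hmap : ∀ x y, H.Adj x y → K.Adj (ι x) (ι y) := fun x y hxy =>
    Or.inl (map_adj_apply' hxy (hι.ne hxy.ne))
  have hadj : ∀ u v, K.Adj u v → (∃ x y, H.Adj x y ∧ ι x = u ∧ ι y = v) ∨
      (u ≠ v ∧ (v = ι (p u) ∨ u = ι (p v))) := by
    rintro u v (huv | huv)
    · exact Or.inl ((map_adj' ι H u v).1 huv).2
    · exact Or.inr ((SimpleGraph.fromRel_adj _ _ _).1 huv)
  have hK : K.Connected := by
    have := hG.nonempty
    refine ⟨fun u v => ?_⟩
    have hr : ∀ v, K.Reachable v (ι (p v)) := fun v => (hpend v).elim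
      (fun hv => hv ▸ Reachable.refl _) Adj.reachable
    exact (hr u).trans ((reachable_map_of_adj ι (fun x y hxy => (hmap x y hxy).reachable)
      (hH.preconnected _ _)).trans (hr v).symm)
  refine ⟨K, hK, fun v => ?_, ?_, ?_, ?_⟩
  -- A vertex u hung on v = ι (p u) has p u = p v, so it lies in the C-ball around ι (p v).
  · have hsub : K.neighborSet v ⊆ (ι '' H.neighborSet (p v) ∪ {ι (p v)}) ∪
        {u | G.dist (ι (p v)) u ≤ C} := by
      intro u hu
      rcases hadj v u hu with ⟨x, y, hxy, rfl, rfl⟩ | ⟨-, rfl | hv⟩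
      · refine Or.inl (Or.inl ⟨y, ?_, rfl⟩)
        rwa [h.leftInv]
      · exact Or.inl (Or.inr rfl)
      · refine Or.inr ?_
        have hpv : p v = p u := by rw [hv, h.leftInv]
        rw [Set.mem_ofPred_eq, hpv, dist_comm]
        exact h.dist_self u
    refine (Set.ncard_le_ncard hsub).trans ((Set.ncard_union_le _ _).trans ?_)
    refine add_le_add ((Set.ncard_union_le _ _).trans ?_) (ncard_closedBall_le hG hd C _)
    refine add_le_add ((Set.ncard_image_le).trans (hd' _)) (Set.ncard_singleton _).le
  · have hsub : K.edgeSet ⊆ Sym2.map ι '' H.edgeSet ∪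
        (fun v => s(v, ι (p v))) '' (Set.range ι)ᶜ := by
      intro e he
      induction e with
      | _ u v =>
      rw [mem_edgeSet] at he
      -- A pendant edge starts outside the range of ι, so there are at most |V| − |W| of them.
      have key : ∀ u v, u ≠ v → v = ι (p u) → u ∉ Set.range ι := by
        rintro _ v huv hv ⟨w, rfl⟩
        rw [h.leftInv] at hv
        exact huv hv.symm
      rcases hadj u v he with ⟨x, y, hxy, rfl, rfl⟩ | ⟨hne, hv | hu⟩
      · exact Or.inl ⟨s(x, y), hxy, rfl⟩
      · exact Or.inr ⟨u, key u v hne hv, by rw [hv]⟩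
      · exact Or.inr ⟨v, key v u hne.symm hu, by rw [hu, Sym2.eq_swap]⟩
    have h1 := (Set.ncard_le_ncard hsub).trans (Set.ncard_union_le _ _)
    have h2 : (Sym2.map ι '' H.edgeSet).ncard ≤ H.edgeSet.ncard := Set.ncard_image_le
    have h3 : ((fun v => s(v, ι (p v))) '' (Set.range ι)ᶜ).ncard ≤ (Set.range ι)ᶜ.ncard :=
      Set.ncard_image_le
    have h4 := Set.ncard_add_ncard_compl (Set.range ι)
    have h5 : (Set.range ι).ncard = Nat.card W := by
      rw [← Set.image_univ, Set.ncard_image_of_injective _ hι, Set.ncard_univ]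
    omega
  · refine fun x y => dist_map_le hK hG id (fun u v huv => ?_) x y
    rcases hadj u v huv with ⟨x, y, hxy, rfl, rfl⟩ | ⟨-, rfl | rfl⟩
    · have := h.dist_incl x y hxy
      simp only [id]; omega
    · have := h.dist_self u
      simp only [id]; omega
    · have := h.dist_self v
      rw [dist_comm] at this
      simp only [id]; omega
  -- Go down a pendant edge, through the copy of `H`, and up a pendant edge: 1 + C + 1.
  · refine fun x y => dist_map_le hG hK id (fun u v huv => ?_) x y
    have h1 : K.dist (ι (p u)) (ι (p v)) ≤ 1 * H.dist (p u) (p v) :=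
      dist_map_le hH hK ι (fun x y hxy => (dist_eq_one_iff_adj.2 (hmap x y hxy)).le) _ _
    have h2 := h.dist_retr u v huv
    have h3 := dist_le_one_of_eq_or_adj (hpend u)
    have h4 := dist_le_one_of_eq_or_adj (hpend v)
    rw [dist_comm] at h4
    have h5 := hK.dist_triangle (u := u) (v := ι (p u)) (w := v)
    have h6 := hK.dist_triangle (u := ι (p u)) (v := ι (p v)) (w := v)
    simp only [id]; omega

/-- Collapsing a spanning forest whose components are rooted in the range of `ι`. -/
theorem exists_forest_retraction (h : CoarseRetract G H ι p C) (hG : G.Connected)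
    (hH : H.Connected) :
    ∃ (par : V → V) (δ : V → ℕ) (q : V → W), (∀ w, q (ι w) = w) ∧
      (∀ v, G.dist v (ι (q v)) ≤ C) ∧ (∀ v, q (par v) = q v) ∧
      ∀ v ∉ Set.range ι, G.Adj v (par v) ∧ δ (par v) < δ v := by
  classical
  have := hH.nonempty
  -- δ is the distance to the range of ι; the parent of a vertex is the next vertex on a geodesic to
  -- that range, and roots are their own parents.
  let δ : V → ℕ := fun v => sInf (Set.range fun w => G.dist v (ι w))
  have hmem : ∀ v, ∃ w, G.dist v (ι w) = δ v := fun v =>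
    Nat.sInf_mem (Set.range_nonempty fun w => G.dist v (ι w))
  have hle : ∀ v w, δ v ≤ G.dist v (ι w) := fun v w => Nat.sInf_le ⟨w, rfl⟩
  have hstep : ∀ v, ∃ u, (v ∈ Set.range ι → u = v) ∧
      (v ∉ Set.range ι → G.Adj v u ∧ δ u < δ v) := by
    intro v
    by_cases hv : v ∈ Set.range ι
    · exact ⟨v, fun _ => rfl, fun hn => absurd hv hn⟩
    obtain ⟨w, hw⟩ := hmem v
    obtain ⟨P, hP⟩ := hG.exists_walk_length_eq_dist v (ι w)
    cases P with
    | nil => exact absurd ⟨w, rfl⟩ hv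
    | @cons _ u _ hadj P =>
      refine ⟨u, fun hn => absurd hn hv, fun _ => ⟨hadj, ?_⟩⟩
      rw [Walk.length_cons] at hP
      have := (hle u w).trans (dist_le P)
      omega
  choose par hfix hpar using hstep
  have hrange : ∀ n v, δ v ≤ n → par^[n] v ∈ Set.range ι := by
    intro n
    induction n with
    | zero =>
      intro v hv
      obtain ⟨w, hw⟩ := hmem v
      exact ⟨w, (hG.dist_eq_zero_iff.1 (Nat.le_zero.1 (hw.trans_le hv))).symm⟩
    | succ n ih =>
      intro v hv
      rw [Function.iterate_succ_apply]
      by_cases hr : v ∈ Set.range ι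
      · rw [hfix v hr]
        obtain ⟨w, rfl⟩ := hr
        exact ih _ ((hle _ w).trans (by simp))
      · exact ih _ (by have := (hpar v hr).2; omega)
  have hdist : ∀ n v, G.dist v (par^[n] v) ≤ n := by
    intro n
    induction n with
    | zero => simp
    | succ n ih =>
      intro v
      rw [Function.iterate_succ_apply]
      have h1 := hG.dist_triangle (u := v) (v := par v) (w := par^[n] (par v))
      have h2 := ih (par v)
      have h3 : G.dist v (par v) ≤ 1 := by
        refine dist_le_one_of_eq_or_adj ?_
        by_cases hr : v ∈ Set.range ι
        · exact Or.inl (hfix v hr).symm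
        · exact Or.inr (hpar v hr).1
      omega
  have hδ : ∀ v, δ v ≤ C := fun v => (hle v (p v)).trans (h.dist_self v)
  -- Since δ ≤ C, C parent steps take every vertex to its root, which is ι (q v).
  choose q hq using fun v => hrange C v (hδ v)
  have hι : ι.Injective := Function.LeftInverse.injective h.leftInv
  refine ⟨par, δ, q, fun w => hι ?_, fun v => ?_, fun v => hι ?_, hpar⟩
  · rw [hq]
    exact Function.iterate_fixed (hfix _ ⟨w, rfl⟩) C
  · rw [hq]
    exact hdist C v
  · rw [hq, hq, ← Function.iterate_succ_apply, Function.iterate_succ_apply']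
    exact hfix _ (hrange C v (hδ v))

/-- A graph with a coarse retract contracts to a graph on the smaller vertex set, losing at least
one edge for every lost vertex. -/
theorem exists_contraction [Finite V] (h : CoarseRetract G H ι p C) (hG : G.Connected)
    (hH : H.Connected) {d : ℕ} (hd : ∀ v, (G.neighborSet v).ncard ≤ d) :
    ∃ K : SimpleGraph W, K.Connected ∧
      (∀ w, (K.neighborSet w).ncard ≤ (d + 1) ^ (C + 1)) ∧
      K.edgeSet.ncard + Nat.card V ≤ G.edgeSet.ncard + Nat.card W ∧
      (∀ x y, H.dist x y ≤ (C * (2 * C + 1) + C) * K.dist x y) ∧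
      (∀ x y, K.dist x y ≤ (C * (2 * C + 1) + C) * H.dist x y) := by
  obtain ⟨par, δ, q, hqι, hqd, hqpar, hpar⟩ := h.exists_forest_retraction hG hH
  have hι : ι.Injective := Function.LeftInverse.injective h.leftInv
  have : Finite W := Finite.of_injective ι hι
  have hreach : ∀ x y, G.Adj x y → q x = q y ∨ (G.map q).Adj (q x) (q y) := by
    intro x y hxy
    by_cases hq : q x = q y
    · exact Or.inl hq
    · exact Or.inr (map_adj_apply' hxy hq)
  have hK : (G.map q).Connected := by
    refine hG.of_surjective (f := q) (fun w => ⟨ι w, hqι w⟩) fun x y hxy => ?_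
    exact (hreach x y hxy).elim (fun hq => hq ▸ Reachable.refl _) Adj.reachable
  refine ⟨G.map q, hK, fun w => ?_, ?_, ?_, ?_⟩
  · have hsub : (G.map q).neighborSet w ⊆ q '' {u | G.dist (ι w) u ≤ C + 1} := by
      intro b hb
      obtain ⟨-, u, v, huv, rfl, rfl⟩ := (map_adj' q G w b).1 hb
      refine ⟨v, ?_, rfl⟩
      have h1 := hqd u
      have h2 := (dist_eq_one_iff_adj.2 huv).le
      have h3 := hG.dist_triangle (u := ι (q u)) (v := u) (w := v)
      rw [dist_comm] at h1
      rw [Set.mem_ofPred_eq]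
      omega
    exact (Set.ncard_le_ncard hsub).trans
      ((Set.ncard_image_le).trans (ncard_closedBall_le hG hd _ _))
  -- Two vertices cannot be each other's parent because δ strictly decreases, so there are exactly
  -- |V| − |W| forest edges.
  · have hF : Set.InjOn (fun v => s(v, par v)) (Set.range ι)ᶜ := by
      intro u hu v hv huv
      rcases Sym2.eq_iff.1 huv with ⟨h1, -⟩ | ⟨h1, h2⟩
      · exact h1
      · have h3 := (hpar u hu).2
        have h4 := (hpar v hv).2
        rw [h2] at h3
        rw [← h1] at h4
        omega
    have hFsub : (fun v => s(v, par v)) '' (Set.range ι)ᶜ ⊆ G.edgeSet := by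
      rintro _ ⟨v, hv, rfl⟩
      exact (hpar v hv).1
    -- Forest edges become loops under q and disappear, so every remaining edge comes from a
    -- non-forest edge.
    have hsub : (G.map q).edgeSet ⊆
        Sym2.map q '' (G.edgeSet \ (fun v => s(v, par v)) '' (Set.range ι)ᶜ) := by
      intro e he
      induction e with
      | _ a b =>
      obtain ⟨hne, u, v, huv, rfl, rfl⟩ := (map_adj' q G a b).1 he
      refine ⟨s(u, v), ⟨huv, ?_⟩, rfl⟩
      rintro ⟨x, -, hx⟩
      rcases Sym2.eq_iff.1 hx with ⟨rfl, rfl⟩ | ⟨rfl, rfl⟩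
      · exact hne (hqpar _).symm
      · exact hne (hqpar _)
    have h1 := (Set.ncard_le_ncard hsub).trans Set.ncard_image_le
    have h2 := Set.ncard_sdiff_add_ncard_of_subset hFsub
    rw [hF.ncard_image] at h2
    have h4 := Set.ncard_add_ncard_compl (Set.range ι)
    have h5 : (Set.range ι).ncard = Nat.card W := by
      rw [← Set.image_univ, Set.ncard_image_of_injective _ hι, Set.ncard_univ]
    omega
  · refine fun x y => dist_map_le hK hH id (fun a b hab => ?_) x y
    obtain ⟨-, u, v, huv, rfl, rfl⟩ := (map_adj' q G a b).1 hab
    have h1 := hqd u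
    have h2 := hqd v
    have h3 := (dist_eq_one_iff_adj.2 huv).le
    have h4 := hG.dist_triangle (u := ι (q u)) (v := u) (w := v)
    have h5 := hG.dist_triangle (u := ι (q u)) (v := v) (w := ι (q v))
    rw [dist_comm] at h1
    -- The roots of adjacent vertices are at distance at most 2C + 1; p is C-Lipschitz and inverts
    -- ι.
    have h6 := dist_map_le hG hH p h.dist_retr (ι (q u)) (ι (q v))
    rw [h.leftInv, h.leftInv] at h6
    have h7 : C * G.dist (ι (q u)) (ι (q v)) ≤ C * (2 * C + 1) :=
      Nat.mul_le_mul_left _ (by omega)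
    simp only [id]; omega
  · refine fun x y => dist_map_le hH hK id (fun a b hab => ?_) x y
    have h1 := h.dist_incl a b hab
    have h2 : (G.map q).dist (q (ι a)) (q (ι b)) ≤ 1 * G.dist (ι a) (ι b) :=
      dist_map_le hG hK q (fun x y hxy => dist_le_one_of_eq_or_adj (hreach x y hxy)) _ _
    rw [hqι, hqι] at h2
    simp only [id]; omega

end CoarseRetract

end SimpleGraph

/-! ### From edge counts to inequalities between costs -/

section Cost

variable {V W : ℕ → Type*} {G : ∀ n, SimpleGraph (V n)} {H : ∀ n, SimpleGraph (W n)}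

theorem BiLipschitzEquiv.exists_nat {G' : ∀ n, SimpleGraph (V n)} (h : BiLipschitzEquiv G G') :
    ∃ D : ℕ, 0 < D ∧ (∀ n x y, (G n).dist x y ≤ D * (G' n).dist x y) ∧
      ∀ n x y, (G' n).dist x y ≤ D * (G n).dist x y := by
  obtain ⟨L, hL, h⟩ := h
  have hle := Nat.le_ceil L
  refine ⟨⌈L⌉₊, Nat.ceil_pos.2 hL, fun n x y => ?_, fun n x y => ?_⟩
  · have h1 := (h n x y).1
    rw [div_le_iff₀ hL, mul_comm] at h1
    exact_mod_cast h1.trans (mul_le_mul_of_nonneg_right hle (Nat.cast_nonneg _))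
  · exact_mod_cast (h n x y).2.trans (mul_le_mul_of_nonneg_right hle (Nat.cast_nonneg _))

theorem BiLipschitzEquiv.of_nat {G' : ∀ n, SimpleGraph (V n)} {D : ℕ} (hD : 0 < D)
    (h1 : ∀ n x y, (G n).dist x y ≤ D * (G' n).dist x y)
    (h2 : ∀ n x y, (G' n).dist x y ≤ D * (G n).dist x y) : BiLipschitzEquiv G G' := by
  have hD' : (0 : ℝ) < D := by exact_mod_cast hD
  refine ⟨D, hD', fun n x y => ⟨?_, by exact_mod_cast h2 n x y⟩⟩
  rw [div_le_iff₀ hD', mul_comm]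
  exact_mod_cast h1 n x y

theorem BiLipschitzEquiv.refl (G : ∀ n, SimpleGraph (V n)) : BiLipschitzEquiv G G :=
  .of_nat one_pos (fun n x y => by simp) (fun n x y => by simp)

theorem IsGraphSequence.card_pos (hG : IsGraphSequence G) (n : ℕ) : 0 < Nat.card (V n) :=
  have := hG.finite n
  have := (hG.connected n).nonempty
  Nat.card_pos

theorem IsGraphSequence.exists_edge_ratio_le (hG : IsGraphSequence G) :
    ∃ d : ℝ, ∀ n, ((G n).edgeSet.ncard : ℝ) / (Nat.card (V n) : ℝ) ≤ d := by
  obtain ⟨d, hd⟩ := hG.boundedDegree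
  refine ⟨d, fun n => ?_⟩
  have := hG.finite n
  rw [div_le_iff₀ (by exact_mod_cast hG.card_pos n)]
  exact_mod_cast SimpleGraph.ncard_edgeSet_le (hd n)

/-- An increasing affine map commutes with liminf. The bounds are needed because a real liminf is
meaningful only for suitably bounded sequences. -/
theorem liminf_le_mul_liminf_add {a b : ℕ → ℝ} {c e D : ℝ} (hc : 0 ≤ c)
    (ha0 : ∀ n, 0 ≤ a n) (haD : ∀ n, a n ≤ D) (hb0 : ∀ n, 0 ≤ b n)
    (h : ∀ n, b n ≤ c * a n + e) : liminf b atTop ≤ c * liminf a atTop + e := by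
  have hmono : Monotone fun x : ℝ => c * x + e := fun x y hxy => by
    have := mul_le_mul_of_nonneg_left hxy hc
    simpa using this
  have hbdd : IsBoundedUnder (· ≤ ·) atTop a := isBoundedUnder_of ⟨D, haD⟩
  have key := hmono.map_liminf_of_continuousAt (F := atTop) a (by fun_prop)
    hbdd.isCoboundedUnder_ge (isBoundedUnder_of ⟨0, ha0⟩)
  refine LE.le.trans ?_ key.ge
  refine liminf_le_liminf (Eventually.of_forall h)
    (isBoundedUnder_of ⟨0, hb0⟩) ?_
  exact IsBoundedUnder.isCoboundedUnder_ge (isBoundedUnder_of ⟨c * D + e, fun n => hmono (haD n)⟩)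

theorem edgeNumber_le_of_ncard_le (hG : IsGraphSequence G) {c e : ℝ} (hc : 0 ≤ c)
    (h : ∀ n, ((H n).edgeSet.ncard : ℝ) / (Nat.card (W n) : ℝ) ≤
      c * (((G n).edgeSet.ncard : ℝ) / (Nat.card (V n) : ℝ)) + e) :
    edgeNumber H ≤ c * edgeNumber G + e := by
  obtain ⟨D, hD⟩ := hG.exists_edge_ratio_le
  exact liminf_le_mul_liminf_add hc (fun n => by positivity) hD (fun n => by positivity) h

theorem edgeNumber_nonneg (hG : IsGraphSequence G) : 0 ≤ edgeNumber G := by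
  obtain ⟨D, hD⟩ := hG.exists_edge_ratio_le
  refine le_liminf_of_le (IsBoundedUnder.isCoboundedUnder_ge
    (isBoundedUnder_of ⟨D, hD⟩)) (Eventually.of_forall fun n => ?_)
  positivity

theorem cost_le_edgeNumber {G' : ∀ n, SimpleGraph (V n)} (hG' : IsGraphSequence G')
    (h : BiLipschitzEquiv G G') : cost G ≤ edgeNumber G' := by
  refine csInf_le ⟨0, ?_⟩ ⟨G', hG', h, rfl⟩
  rintro _ ⟨K, hK, -, rfl⟩
  exact edgeNumber_nonneg hK

theorem le_cost (hG : IsGraphSequence G) {a : ℝ}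
    (h : ∀ G' : ∀ n, SimpleGraph (V n), IsGraphSequence G' → BiLipschitzEquiv G G' →
      a ≤ edgeNumber G') : a ≤ cost G := by
  refine le_csInf ⟨_, G, hG, .refl G, rfl⟩ ?_
  rintro _ ⟨K, hK, hGK, rfl⟩
  exact h K hK hGK

/-- Collapsing a coarse retract bounds the cost of the smaller graph sequence. -/
theorem cost_sub_one_le_of_coarseRetract (hG : IsGraphSequence G) (hH : IsGraphSequence H)
    {ι : ∀ n, W n → V n} {p : ∀ n, V n → W n} {C m : ℕ}
    (h : ∀ n, (G n).CoarseRetract (H n) (ι n) (p n) C) (hm : 0 < m)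
    (hcard : ∀ n, Nat.card (V n) = m * Nat.card (W n)) :
    cost H - 1 ≤ m * (cost G - 1) := by
  have hm' : (0 : ℝ) < m := by exact_mod_cast hm
  suffices (cost H - 1) / m + 1 ≤ cost G by
    rwa [← le_sub_iff_add_le, div_le_iff₀ hm', mul_comm] at this
  refine le_cost hG fun G' hG' hGG' => ?_
  obtain ⟨D, hD, h1, h2⟩ := hGG'.exists_nat
  obtain ⟨d, hd⟩ := hG'.boundedDegree
  -- The added 1 makes the resulting bi-Lipschitz constant positive even when C = 0.
  have hG'H : ∀ n, (G' n).CoarseRetract (H n) (ι n) (p n) (D * C + 1) := fun n =>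
    ((h n).congr_left (hG.connected n) (hH.connected n) (h1 n) (h2 n)).mono (Nat.le_succ _)
  have hfin := hG.finite
  choose K hKc hKd hKe hK1 hK2 using fun n =>
    (hG'H n).exists_contraction (hG'.connected n) (hH.connected n) (hd n)
  have hK : IsGraphSequence K := ⟨hH.finite, hKc, ⟨_, hKd⟩, hH.tendsto_card⟩
  have hle := cost_le_edgeNumber hK (BiLipschitzEquiv.of_nat (by positivity) hK1 hK2)
  -- This is |E(K)| ≤ |E(G')| − (m − 1)|W| divided by |W|, with |V| = m|W|.
  have hKG : edgeNumber K ≤ m * edgeNumber G' + (1 - m) := by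
    refine edgeNumber_le_of_ncard_le hG' hm'.le fun n => ?_
    have hW : (0 : ℝ) < Nat.card (W n) := by exact_mod_cast hH.card_pos n
    have hn : ((K n).edgeSet.ncard : ℝ) + Nat.card (V n) ≤
        (G' n).edgeSet.ncard + Nat.card (W n) := by exact_mod_cast hKe n
    rw [hcard n, Nat.cast_mul] at hn ⊢
    rw [div_le_iff₀ hW]
    have : (m * ((G' n).edgeSet.ncard / (m * Nat.card (W n))) + (1 - m)) * (Nat.card (W n) : ℝ) =
        (G' n).edgeSet.ncard + (1 - m) * Nat.card (W n) := by field_simp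
    rw [this]
    linarith
  rw [← le_sub_iff_add_le, div_le_iff₀ hm']
  linarith

/-- Attaching pendant vertices bounds the cost of the larger graph sequence. -/
theorem mul_cost_sub_one_le_of_coarseRetract (hG : IsGraphSequence G) (hH : IsGraphSequence H)
    {ι : ∀ n, W n → V n} {p : ∀ n, V n → W n} {C m : ℕ}
    (h : ∀ n, (G n).CoarseRetract (H n) (ι n) (p n) C) (hm : 0 < m)
    (hcard : ∀ n, Nat.card (V n) = m * Nat.card (W n)) :
    m * (cost G - 1) ≤ cost H - 1 := by
  have hm' : (0 : ℝ) < m := by exact_mod_cast hm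
  suffices m * (cost G - 1) + 1 ≤ cost H by linarith
  refine le_cost hH fun H' hH' hHH' => ?_
  obtain ⟨D, hD, h1, h2⟩ := hHH'.exists_nat
  obtain ⟨d, hd⟩ := hG.boundedDegree
  obtain ⟨d', hd'⟩ := hH'.boundedDegree
  have hGH' : ∀ n, (G n).CoarseRetract (H' n) (ι n) (p n) (D * C) := fun n =>
    (h n).congr_right (hG.connected n) (hH.connected n) hD (h1 n) (h2 n)
  have hfin := hG.finite
  choose K hKc hKd hKe hK1 hK2 using fun n =>
    (hGH' n).exists_extension (hG.connected n) (hH'.connected n) (hd n) (hd' n)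
  have hK : IsGraphSequence K := ⟨hG.finite, hKc, ⟨_, hKd⟩, hG.tendsto_card⟩
  have hle := cost_le_edgeNumber hK (BiLipschitzEquiv.of_nat (by positivity) hK1 hK2)
  have hKH : edgeNumber K ≤ (m : ℝ)⁻¹ * edgeNumber H' + (1 - (m : ℝ)⁻¹) := by
    refine edgeNumber_le_of_ncard_le hH' (by positivity) fun n => ?_
    have hW : (0 : ℝ) < Nat.card (W n) := by exact_mod_cast hH.card_pos n
    have hn : ((K n).edgeSet.ncard : ℝ) + Nat.card (W n) ≤
        (H' n).edgeSet.ncard + Nat.card (V n) := by exact_mod_cast hKe n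
    rw [hcard n, Nat.cast_mul] at hn ⊢
    rw [div_le_iff₀ (by positivity)]
    have : ((m : ℝ)⁻¹ * ((H' n).edgeSet.ncard / Nat.card (W n)) + (1 - (m : ℝ)⁻¹)) *
        (m * Nat.card (W n) : ℝ) =
        (H' n).edgeSet.ncard + (m - 1) * Nat.card (W n) := by field_simp
    rw [this]
    linarith
  have h3 : m * (cost G - 1) ≤
      m * ((m : ℝ)⁻¹ * edgeNumber H' + (1 - (m : ℝ)⁻¹) - 1) :=
    mul_le_mul_of_nonneg_left (by linarith) hm'.le
  have h4 : m * ((m : ℝ)⁻¹ * edgeNumber H' + (1 - (m : ℝ)⁻¹) - 1) = edgeNumber H' - 1 := by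
    field_simp
    ring
  linarith

end Cost

/-! ### Schreier graphs and the retraction onto the subgroup -/

section Schreier

variable {Γ : Type*} [Group Γ]

/-- The right coset `N g`. -/
abbrev RightCosets.mk (N : Subgroup Γ) (g : Γ) : RightCosets N := Quotient.mk _ g

namespace RightCosets

theorem mk_eq_mk {N : Subgroup Γ} {g h : Γ} : mk N g = mk N h ↔ h * g⁻¹ ∈ N := by
  rw [mk, mk, Quotient.eq, QuotientGroup.rightRel_apply]

theorem card_eq_index (N : Subgroup Γ) : Nat.card (RightCosets N) = N.index :=
  Nat.card_congr (QuotientGroup.quotientRightRelEquivQuotientLeftRel N)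

theorem finite (N : Subgroup Γ) [N.FiniteIndex] : Finite (RightCosets N) :=
  Nat.finite_of_card_ne_zero (by rw [card_eq_index]; exact Subgroup.FiniteIndex.index_ne_zero)

theorem infinite_bot [Infinite Γ] : Infinite (RightCosets (⊥ : Subgroup Γ)) := by
  refine Infinite.of_injective (mk ⊥) fun g h hgh => ?_
  rw [mk_eq_mk, Subgroup.mem_bot, mul_inv_eq_one] at hgh
  exact hgh.symm

end RightCosets

open RightCosets

/-- A word for γ in the generators can be read from any coset, so L depends on γ alone. Walks,
unlike `dist`, also yield connectedness. -/
theorem exists_walk_schreierGraph (S : Finset Γ) (hS : Subgroup.closure (S : Set Γ) = ⊤) (γ : Γ) :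
    ∃ L : ℕ, ∀ (N : Subgroup Γ) (g : Γ),
      ∃ P : (schreierGraph N S).toSimple.Walk (mk N g) (mk N (g * γ)), P.length ≤ L := by
  have hγ : γ ∈ Subgroup.closure (S : Set Γ) := hS ▸ Subgroup.mem_top γ
  induction hγ using Subgroup.closure_induction with
  | mem s hs =>
    refine ⟨1, fun N g => ?_⟩
    by_cases h : mk N g = mk N (g * s)
    · rw [← h]
      exact ⟨.nil, by simp⟩
    · have hadj : (schreierGraph N S).toSimple.Adj (mk N g) (mk N (g * s)) :=
        (SimpleGraph.fromRel_adj _ _ _).2 ⟨h, Or.inl ⟨⟨s, hs⟩, g, rfl, rfl⟩⟩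
      exact ⟨hadj.toWalk, by simp⟩
  | one =>
    refine ⟨0, fun N g => ?_⟩
    rw [mul_one]
    exact ⟨.nil, by simp⟩
  | mul a b _ _ ha hb =>
    obtain ⟨L, hL⟩ := ha
    obtain ⟨M, hM⟩ := hb
    refine ⟨L + M, fun N g => ?_⟩
    obtain ⟨P, hP⟩ := hL N g
    obtain ⟨Q, hQ⟩ := hM N (g * a)
    rw [← mul_assoc]
    exact ⟨P.append Q, by rw [SimpleGraph.Walk.length_append]; omega⟩
  | inv a _ ha =>
    obtain ⟨L, hL⟩ := ha
    refine ⟨L, fun N g => ?_⟩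
    have hN := hL N (g * a⁻¹)
    rw [inv_mul_cancel_right] at hN
    obtain ⟨P, hP⟩ := hN
    exact ⟨P.reverse, by rwa [SimpleGraph.Walk.length_reverse]⟩

theorem exists_dist_schreierGraph_le (S : Finset Γ) (hS : Subgroup.closure (S : Set Γ) = ⊤)
    {α : Type*} [Finite α] (f : α → Γ) :
    ∃ L : ℕ, ∀ (N : Subgroup Γ) (g : Γ) (a : α),
      (schreierGraph N S).toSimple.dist (mk N g) (mk N (g * f a)) ≤ L := by
  choose L hL using exists_walk_schreierGraph S hS
  obtain ⟨M, hM⟩ := Finite.exists_le fun a => L (f a)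
  refine ⟨M, fun N g a => ?_⟩
  obtain ⟨P, hP⟩ := hL (f a) N g
  exact ((SimpleGraph.dist_le P).trans hP).trans (hM a)

theorem schreierGraph_connected (N : Subgroup Γ) (S : Finset Γ)
    (hS : Subgroup.closure (S : Set Γ) = ⊤) : (schreierGraph N S).toSimple.Connected := by
  have : Nonempty (RightCosets N) := ⟨mk N 1⟩
  refine ⟨fun x y => ?_⟩
  induction x using Quotient.inductionOn with
  | _ g =>
  induction y using Quotient.inductionOn with
  | _ h =>
  obtain ⟨L, hL⟩ := exists_walk_schreierGraph S hS (g⁻¹ * h)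
  obtain ⟨P, -⟩ := hL N g
  rw [mul_inv_cancel_left] at P
  exact P.reachable

/-- To bound a symmetric quantity along the edges of a Schreier graph it suffices to consider the
steps `N g → N g s`. -/
theorem schreierGraph_adj_induction {N : Subgroup Γ} {S : Finset Γ}
    {P : RightCosets N → RightCosets N → Prop} (hsymm : ∀ x y, P x y → P y x)
    (h : ∀ (g : Γ) (s : S), P (mk N g) (mk N (g * s))) (x y : RightCosets N)
    (hxy : (schreierGraph N S).toSimple.Adj x y) : P x y := by
  rcases ((SimpleGraph.fromRel_adj _ _ _).1 hxy).2 with ⟨s, g, rfl, rfl⟩ | ⟨s, g, rfl, rfl⟩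
  · exact h g s
  · exact hsymm _ _ (h g s)

theorem ncard_neighborSet_schreierGraph_le (N : Subgroup Γ) (S : Finset Γ) (x : RightCosets N) :
    ((schreierGraph N S).toSimple.neighborSet x).ncard ≤ 2 * S.card := by
  induction x using Quotient.inductionOn with
  | _ g =>
  have hsub : (schreierGraph N S).toSimple.neighborSet (mk N g) ⊆
      (fun s => mk N (g * s)) '' S ∪ (fun s => mk N (g * s⁻¹)) '' S := by
    intro y hy
    rw [SimpleGraph.mem_neighborSet] at hy
    rcases ((SimpleGraph.fromRel_adj _ _ _).1 hy).2 with ⟨s, h, hg, rfl⟩ | ⟨s, h, rfl, hg⟩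
    · refine Or.inl ⟨s, s.2, mk_eq_mk.2 ?_⟩
      have := mk_eq_mk.1 hg
      simpa [mul_assoc] using this
    · refine Or.inr ⟨s, s.2, mk_eq_mk.2 ?_⟩
      have := mk_eq_mk.1 hg
      simpa [mul_assoc] using this
  refine (Set.ncard_le_ncard hsub ((S.finite_toSet.image _).union (S.finite_toSet.image _))).trans
    ((Set.ncard_union_le _ _).trans ?_)
  have h1 := Set.ncard_image_le (f := fun s => mk N (g * s)) S.finite_toSet
  have h2 := Set.ncard_image_le (f := fun s => mk N (g * s⁻¹)) S.finite_toSet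
  rw [Set.ncard_coe_finset] at h1 h2
  omega

theorem isGraphSequence_schreierGraph (S : Finset Γ) (hS : Subgroup.closure (S : Set Γ) = ⊤)
    (N : ℕ → Subgroup Γ) (hfin : ∀ k, (N k).FiniteIndex)
    (hN : Tendsto (fun k => (N k).index) atTop atTop) :
    IsGraphSequence fun k => (schreierGraph (N k) S).toSimple where
  finite k := RightCosets.finite (N k)
  connected k := schreierGraph_connected (N k) S hS
  boundedDegree := ⟨_, fun k => ncard_neighborSet_schreierGraph_le (N k) S⟩
  tendsto_card := by simpa only [card_eq_index] using hN

/-- The Cayley graph is infinite, so some r-ball contains M vertices. Once the density of good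
vertices is positive, a copy of that ball sits in the Schreier graph. -/
theorem IsFarber.tendsto_index [Infinite Γ] {S : Finset Γ}
    (hS : Subgroup.closure (S : Set Γ) = ⊤) {N : ℕ → Subgroup Γ} (hN : IsFarber S N) :
    Tendsto (fun k => (N k).index) atTop atTop := by
  refine tendsto_atTop.2 fun M => ?_
  have := infinite_bot (Γ := Γ)
  obtain ⟨A, hA⟩ := Infinite.exists_subset_card_eq (RightCosets (⊥ : Subgroup Γ)) M
  have hconn := schreierGraph_connected ⊥ S hS
  obtain ⟨r, hr⟩ := Finite.exists_le fun a : A =>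
    (schreierGraph ⊥ S).toSimple.dist (RightCosets.mk ⊥ (1 : Γ)) a
  have hball : (A : Set (RightCosets (⊥ : Subgroup Γ))) ⊆ (cayleyGraph S).ball (RightCosets.mk ⊥ 1) r := by
    intro a ha
    change (schreierGraph ⊥ S).toSimple.edist _ _ ≤ _
    rw [← (hconn.preconnected _ _).coe_dist_eq_edist]
    exact_mod_cast hr ⟨a, ha⟩
  filter_upwards [(hN.tendsto r).eventually_const_lt zero_lt_one] with k hk
  have := hN.finiteIndex k
  have := RightCosets.finite (N k)
  have hne : {x | (schreierGraph (N k) S).BallIso x (cayleyGraph S) (RightCosets.mk ⊥ 1) r}.ncard ≠ 0 := by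
    intro h0
    rw [LabelledGraph.ballDensity] at hk
    simp [h0] at hk
  obtain ⟨x, e, -⟩ := Set.nonempty_of_ncard_ne_zero hne
  rw [← card_eq_index, ← hA, ← Nat.card_eq_finsetCard]
  exact Nat.card_le_card_of_injective
    (fun a : A => (e.symm ⟨a, hball a.2⟩ : RightCosets (N k)))
    fun a b hab => Subtype.ext
      (Subtype.mk.inj (e.symm.injective (Subtype.ext hab)))

/-- A retraction of `Γ` onto the subgroup `Λ` that commutes with the left multiplication by
elements of `Λ`. -/
theorem exists_equivariant_retraction (Λ : Subgroup Γ) :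
    ∃ (r : Γ → Λ) (t : RightCosets Λ → Γ), (∀ l : Λ, r l = l) ∧ (∀ (l : Λ) g, r (l * g) = l * r g) ∧
      (∀ g, (r g : Γ) = g * (t (mk Λ g))⁻¹) ∧ ∀ g, ∃ l : Λ, g = l * (mk Λ g).out := by
  have hout : ∀ g, g * (mk Λ g).out⁻¹ ∈ Λ := fun g =>
    mk_eq_mk.1 (Quotient.out_eq (mk Λ g))
  have h1 : (mk Λ 1).out ∈ Λ := by simpa using Λ.inv_mem (hout 1)
  have hr : ∀ g, g * ((mk Λ 1).out⁻¹ * (mk Λ g).out)⁻¹ ∈ Λ := fun g => by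
    rw [mul_inv_rev, inv_inv, ← mul_assoc]
    exact Λ.mul_mem (hout g) h1
  have hmk : ∀ (l : Λ) g, mk Λ (l * g) = mk Λ g := fun l g => by
    rw [mk_eq_mk]
    simp
  -- The representatives are normalised so that t is 1 on the coset Λ; this makes r the identity on
  -- Λ.
  refine ⟨fun g => ⟨_, hr g⟩, fun c => (mk Λ 1).out⁻¹ * c.out, fun l => ?_, fun l g => ?_,
    fun g => rfl, fun g => ⟨⟨_, hout g⟩, by simp⟩⟩
  · have := hmk l 1
    rw [mul_one] at this
    ext
    simp only [this]
    group
  · ext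
    simp only [hmk, Subgroup.coe_mul, mul_assoc]

/-- All three bounds concern right multiplication by elements of finite families indexed by `S'`, by
Λ-cosets paired with `S`, and by Λ-cosets. None of these depends on N. -/
theorem exists_coarseRetract_schreierGraph (S : Finset Γ)
    (hS : Subgroup.closure (S : Set Γ) = ⊤) (Λ : Subgroup Γ) [Λ.FiniteIndex] (S' : Finset Λ)
    (hS' : Subgroup.closure (S' : Set Λ) = ⊤) :
    ∃ C : ℕ, ∀ N ≤ Λ, ∃ (ι : RightCosets (N.subgroupOf Λ) → RightCosets N)
      (p : RightCosets N → RightCosets (N.subgroupOf Λ)),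
      (schreierGraph N S).toSimple.CoarseRetract (schreierGraph (N.subgroupOf Λ) S').toSimple
        ι p C := by
  obtain ⟨r, t, hr, hrmul, hrt, hout⟩ := exists_equivariant_retraction Λ
  have := RightCosets.finite Λ
  obtain ⟨C₁, h₁⟩ := exists_dist_schreierGraph_le S hS fun s : S' => ((s : Λ) : Γ)
  obtain ⟨C₂, h₂⟩ := exists_dist_schreierGraph_le S' hS' fun a : RightCosets Λ × S =>
    (r a.1.out)⁻¹ * r (a.1.out * a.2)
  obtain ⟨C₃, h₃⟩ := exists_dist_schreierGraph_le S hS fun c => (t c)⁻¹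
  refine ⟨C₁ + C₂ + C₃, fun N hN => ?_⟩
  let ι : RightCosets (N.subgroupOf Λ) → RightCosets N :=
    Quotient.lift (fun l : Λ => mk N (l : Γ)) fun a b hab => by
      have hab := QuotientGroup.rightRel_apply.1 hab
      rw [mk_eq_mk]
      exact hab
  let p : RightCosets N → RightCosets (N.subgroupOf Λ) :=
    Quotient.lift (fun g => mk (N.subgroupOf Λ) (r g)) fun a b hab => by
      have hab := QuotientGroup.rightRel_apply.1 hab
      -- Left equivariance makes p well defined, as b a⁻¹ ∈ N ≤ Λ.
      have hb : r b = ⟨b * a⁻¹, hN hab⟩ * r a := by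
        rw [← hrmul, inv_mul_cancel_right]
      rw [mk_eq_mk, hb, mul_inv_cancel_right]
      exact hab
  refine ⟨ι, p, fun w => ?_, ?_, ?_, fun v => ?_⟩
  · induction w using Quotient.inductionOn with
    | _ l => exact congrArg (mk (N.subgroupOf Λ)) (hr l)
  · refine schreierGraph_adj_induction (fun x y hxy => by rwa [SimpleGraph.dist_comm]) ?_
    intro l s
    have := h₁ N l s
    exact le_trans this (by omega)
  · refine schreierGraph_adj_induction (fun x y hxy => by rwa [SimpleGraph.dist_comm]) ?_
    intro g s
    obtain ⟨l, hl⟩ := hout g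
    have := h₂ (N.subgroupOf Λ) (r g) (mk Λ g, s)
    -- With g = l u, u the chosen representative, equivariance cancels l: the step from r g to r (g
    -- s) depends only on u and s.
    have hgs : r g * ((r (mk Λ g).out)⁻¹ * r ((mk Λ g).out * s)) = r (g * s) := by
      generalize (mk Λ g).out = u at hl
      rw [hl, mul_assoc, hrmul, hrmul]
      group
    rw [hgs] at this
    exact le_trans this (by omega)
  · induction v using Quotient.inductionOn with
    | _ g =>
    have := h₃ N g (mk Λ g)
    rw [← hrt] at this
    exact le_trans this (by omega)

end Schreier

theorem mainTheorem3 {Γ : Type*} [Group Γ] [Infinite Γ] [Group.ResiduallyFinite Γ]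
    (S : Finset Γ) (hS : Subgroup.closure (S : Set Γ) = ⊤)
    (Λ : Subgroup Γ) [Λ.FiniteIndex]
    (S' : Finset Λ) (hS' : Subgroup.closure (S' : Set Λ) = ⊤)
    (N : ℕ → Subgroup Γ) (hN : IsFarber S N) (hNΛ : ∀ k, N k ≤ Λ) :
    IsGraphSequence (fun k => (schreierGraph (N k) S).toSimple) ∧
    IsGraphSequence (fun k => (schreierGraph ((N k).subgroupOf Λ) S').toSimple) ∧
    (Λ.index : ℝ) * (cost (fun k => (schreierGraph (N k) S).toSimple) - 1) =
      cost (fun k => (schreierGraph ((N k).subgroupOf Λ) S').toSimple) - 1 := by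
  have hindex := hN.tendsto_index hS
  have hfin := hN.finiteIndex
  have hmul : ∀ k, (N k).index = Λ.index * ((N k).subgroupOf Λ).index := fun k => by
    rw [mul_comm]
    exact (Subgroup.relIndex_mul_index (hNΛ k)).symm
  have hpos : 0 < Λ.index := Nat.pos_of_ne_zero Subgroup.FiniteIndex.index_ne_zero
  have hG := isGraphSequence_schreierGraph S hS N hfin hindex
  have hH : IsGraphSequence fun k => (schreierGraph ((N k).subgroupOf Λ) S').toSimple := by
    refine isGraphSequence_schreierGraph S' hS' _ (fun k => inferInstance) ?_
    refine tendsto_atTop.2 fun b => ?_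
    filter_upwards [hindex.eventually_ge_atTop (Λ.index * b)] with k hk
    rw [hmul k] at hk
    exact Nat.le_of_mul_le_mul_left hk hpos
  obtain ⟨C, hC⟩ := exists_coarseRetract_schreierGraph S hS Λ S' hS'
  choose ι p hιp using fun k => hC (N k) (hNΛ k)
  have hcard : ∀ k, Nat.card (RightCosets (N k)) =
      Λ.index * Nat.card (RightCosets ((N k).subgroupOf Λ)) := fun k => by
    rw [RightCosets.card_eq_index, RightCosets.card_eq_index, hmul k]
  exact ⟨hG, hH, le_antisymm (mul_cost_sub_one_le_of_coarseRetract hG hH hιp hpos hcard)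
    (cost_sub_one_le_of_coarseRetract hG hH hιp hpos hcard)⟩
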